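/- Let $p$ be a prime, let $G$ be a finite group and let $N$ be a normal subgroup of $G$ such that $G/N$ is a simple group (possibly cyclic of prime order) whose order is not divisible by $p$. Write $\mathrm{Irr}(H)$ for the set of irreducible complex characters of a finite group $H$. For $\chi\in\mathrm{Irr}(H)$, let $\mathbb{Q}(\chi)$ be the field generated over $\mathbb{Q}$ by the values of $\chi$, and let the conductor $c(\chi)$ be the smallest integer $n\ge 1$ such that $\mathbb{Q}(\chi)\subseteq\mathbb{Q}(e^{2\pi i/n})$. For an integer $n\ge1$, let $n_p$ denote the largest power of $p$ dividing $n$. A character $\chi$ is called $p$-rational if $c(\chi)_p=1$. For $\theta\in\mathrm{Irr}(N)$, let $\mathrm{Irr}(G|\theta)$ be the set of those $\chi\in\mathrm{Irr}(G)$ such that $\theta$ is a constituent of the restriction of $\chi$ to $N$. Let $\theta\in\mathrm{Irr}(N)$ be $p$-rational and $G$-invariant, that is, $\theta(gng^{-1})=\theta(n)$ for all $g\in G$ and $n\in N$. Then every $\chi\in\mathrm{Irr}(G|\theta)$ satisfies $c(\chi)_p\le p$. -/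

import Mathlib

open scoped ComplexConjugate

/-- `Irr(H)`: the set of characters (traces) of the irreducible finite-dimensional complex
representations of `H`. Every such representation is isomorphic to one on some `ℂⁿ`. -/
def Irr (H : Type*) [Group H] : Set (H → ℂ) :=
  {χ | ∃ (n : ℕ) (ρ : Representation ℂ H (Fin n → ℂ)), ρ.IsIrreducible ∧ ρ.character = χ}

/-- The inner product `[χ, ψ] = |H|⁻¹ ∑ₕ χ(h) conj(ψ(h))` of complex functions on a finite group. -/
noncomputable def charInner {H : Type*} [Group H] [Finite H] (χ ψ : H → ℂ) : ℂ :=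
  (Nat.card H : ℂ)⁻¹ * ∑ᶠ h : H, χ h * conj (ψ h)

/-- `Irr(G|θ)`: the irreducible characters `χ` of `G` lying over `θ`, that is, such that `θ` is a
constituent of the restriction of `χ` to `N`. -/
def IrrOver {G : Type*} [Group G] [Finite G] {N : Subgroup G} (θ : N → ℂ) : Set (G → ℂ) :=
  {χ | χ ∈ Irr G ∧ charInner (fun n : N => χ n) θ ≠ 0}

/-- `θ` is fixed by the conjugation action of `G` on functions on the normal subgroup `N`. -/
def IsGInvariant {G : Type*} [Group G] {N : Subgroup G} [hN : N.Normal] (θ : N → ℂ) : Prop :=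
  ∀ (g : G) (n : N), θ ⟨g * n * g⁻¹, hN.conj_mem n n.2 g⟩ = θ n

/-- The `n`-th cyclotomic field `ℚ(e^{2πi/n})`, as a subfield of `ℂ`. -/
noncomputable def cyclotomicSubfield (n : ℕ) : IntermediateField ℚ ℂ :=
  IntermediateField.adjoin ℚ {Complex.exp (2 * Real.pi * Complex.I / n)}

/-- The field of values `ℚ(χ)`. -/
noncomputable def fieldOfValues {H : Type*} (χ : H → ℂ) : IntermediateField ℚ ℂ :=
  IntermediateField.adjoin ℚ (Set.range χ)

/-- The conductor `c(χ)`: the smallest `n ≥ 1` such that `ℚ(χ)` lies in the `n`-th cyclotomic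
field. -/
noncomputable def charConductor {H : Type*} (χ : H → ℂ) : ℕ :=
  sInf {n : ℕ | 0 < n ∧ fieldOfValues χ ≤ cyclotomicSubfield n}

/-- The `p`-part `n_p` of `n ≥ 1`: the largest power of `p` dividing `n`. -/
def pPart (p n : ℕ) : ℕ := p ^ n.factorization p

/-- A character is `p`-rational when the `p`-part of its conductor is `1`. -/
def IsPRational {H : Type*} (p : ℕ) (χ : H → ℂ) : Prop := pPart p (charConductor χ) = 1

/-- The field of values of an irreducible character of a finite group `H` lies in the `|H|`-th
cyclotomic field. -/
theorem fieldOfValues_le_cyclotomicSubfield {H : Type*} [Group H] [Finite H] {χ : H → ℂ}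
    (hχ : χ ∈ Irr H) : fieldOfValues χ ≤ cyclotomicSubfield (Nat.card H) := by
  obtain ⟨n, ρ, -, rfl⟩ := hχ
  refine IntermediateField.adjoin_le_iff.2 ?_
  rintro _ ⟨g, rfl⟩
  have hpow : (ρ g) ^ Nat.card H = 1 := by rw [← map_pow, pow_card_eq_one', map_one]
  rw [SetLike.mem_coe, Representation.character,
    Module.End.trace_eq_sum_roots_charpoly_of_splits (IsAlgClosed.splits _)]
  refine multiset_sum_mem _ fun z hz => ?_
  have hroot := Polynomial.isRoot_of_mem_roots hz
  rw [← Module.End.hasEigenvalue_iff_isRoot_charpoly] at hroot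
  obtain ⟨v, hv⟩ := hroot.exists_hasEigenvector
  have h1 := hv.pow_apply (Nat.card H)
  rw [hpow, Module.End.one_apply] at h1
  have hz1 : z ^ Nat.card H = 1 := by
    have h2 : (z ^ Nat.card H - 1) • v = 0 := by rw [sub_smul, one_smul, ← h1, sub_self]
    exact sub_eq_zero.1 ((smul_eq_zero.1 h2).resolve_right hv.2)
  obtain ⟨i, -, rfl⟩ :=
    (Complex.isPrimitiveRoot_exp _ Nat.card_pos.ne').eq_pow_of_pow_eq_one hz1
  exact pow_mem (IntermediateField.subset_adjoin ℚ _ (Set.mem_singleton _)) i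

/-- The minimum defining the conductor of an irreducible character of a finite group exists. -/
theorem charConductor_spec {H : Type*} [Group H] [Finite H] {χ : H → ℂ} (hχ : χ ∈ Irr H) :
    0 < charConductor χ ∧ fieldOfValues χ ≤ cyclotomicSubfield (charConductor χ) :=
  Nat.sInf_mem (s := {n : ℕ | 0 < n ∧ fieldOfValues χ ≤ cyclotomicSubfield n})
    ⟨Nat.card H, Nat.card_pos, fieldOfValues_le_cyclotomicSubfield hχ⟩

/-! Write `|G| = p ^ a * m` with `p ∤ m`, and `ℚ_n` for the `n`-th cyclotomic field. It suffices to
show that each `χ(g)` lies in `ℚ_{pm}`: the conductor divides every `n` with `ℚ(χ) ≤ ℚ_n`, because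
`ℚ_a ∩ ℚ_b = ℚ_{gcd(a,b)}` (`charConductor_dvd`).

Let `k` be the order of `gN`, a divisor of `m`, and let `ρ` afford `θ`. By invariance some `X` acts
on `ρ` as `g` does, with `X ^ k = ρ (g ^ k)`. By Clifford and Schur, `χ` restricts to copies of `ρ`,
and `g` acts as `Y ⊗ X` with `Y ^ k = 1`. Thus `χ(g) = tr Y * tr X`, where `tr Y ∈ ℚ_k`.

For `tr X`, averaging over `N` expresses `(tr X) ^ k` rationally through the values of `θ`
(`trace_pow_mem`), so it lies in `ℚ_{pm}`. Since `X` has finite order, `tr X` lies in `ℚ_{p^(a+1)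
m}`, of degree `p ^ a` over `ℚ_{pm}`. As `k` is prime to `p` and `ℚ_{pm}` contains the `k`-th roots
of unity, `tr X ∈ ℚ_{pm}`. -/

/-! ### Intersections of cyclotomic fields and the conductor -/

theorem isPrimitiveRoot_exp_cyclotomicSubfield (n : ℕ) [NeZero n] :
    IsPrimitiveRoot (Complex.exp (2 * Real.pi * Complex.I / n)) n :=
  Complex.isPrimitiveRoot_exp n (NeZero.ne n)

instance isCyclotomicExtension_cyclotomicSubfield (n : ℕ) [NeZero n] :
    @IsCyclotomicExtension {n} ℚ (cyclotomicSubfield n) _ _ (cyclotomicSubfield n).algebra' :=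
  (IntermediateField.isCyclotomicExtension_singleton_iff_eq_adjoin n ℚ ℂ _
    (isPrimitiveRoot_exp_cyclotomicSubfield n)).2 rfl

theorem cyclotomicSubfield_mono {m n : ℕ} [NeZero n] (h : m ∣ n) :
    cyclotomicSubfield m ≤ cyclotomicSubfield n := by
  have : NeZero m := ⟨fun h0 => NeZero.ne n (by simpa [h0] using h)⟩
  exact IntermediateField.isCyclotomicExtension_le_of_dvd ℚ ℂ m n _ _ h

theorem mem_cyclotomicSubfield_of_pow_eq_one {n : ℕ} [NeZero n] {z : ℂ} (h : z ^ n = 1) :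
    z ∈ cyclotomicSubfield n := by
  obtain ⟨i, -, rfl⟩ := (isPrimitiveRoot_exp_cyclotomicSubfield n).eq_pow_of_pow_eq_one h
  exact pow_mem (IntermediateField.subset_adjoin ℚ _ (Set.mem_singleton _)) i

theorem totient_gcd_mul_totient_lcm (a b : ℕ) :
    (a.gcd b).totient * (a.lcm b).totient = a.totient * b.totient := by
  rcases Nat.eq_zero_or_pos (a.gcd b) with h0 | h0
  · rw [Nat.gcd_eq_zero_iff] at h0
    simp [h0.1, h0.2]
  · refine Nat.eq_of_mul_eq_mul_right h0 ?_
    rw [← Nat.totient_gcd_mul_totient_mul, ← Nat.gcd_mul_lcm a b]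
    have h := Nat.totient_gcd_mul_totient_mul (a.gcd b) (a.lcm b)
    rw [Nat.gcd_eq_left ((Nat.gcd_dvd_left a b).trans (Nat.dvd_lcm_left a b))] at h
    exact h.symm

theorem IntermediateField.finrank_mul_finrank_extendScalars {F E : Type*} [Field F] [Field E]
    [Algebra F E] {I A : IntermediateField F E} (h : I ≤ A) :
    Module.finrank F I * Module.finrank I (IntermediateField.extendScalars h) =
      Module.finrank F A :=
  Module.finrank_mul_finrank F I (IntermediateField.extendScalars h)

theorem IntermediateField.linearDisjoint_extendScalars {F E : Type*} [Field F] [Field E]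
    [Algebra F E] {I A B : IntermediateField F E} [IsGalois F A] [FiniteDimensional F A]
    [FiniteDimensional F B] (hA : I ≤ A) (hB : I ≤ B) (h : A ⊓ B ≤ I) :
    (IntermediateField.extendScalars hA).LinearDisjoint (IntermediateField.extendScalars hB) := by
  have : FiniteDimensional F (IntermediateField.extendScalars hA) :=
    inferInstanceAs (FiniteDimensional F A)
  have : FiniteDimensional F (IntermediateField.extendScalars hB) :=
    inferInstanceAs (FiniteDimensional F B)
  have : IsGalois F (IntermediateField.extendScalars hA) := inferInstanceAs (IsGalois F A)
  have : IsGalois I (IntermediateField.extendScalars hA) :=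
    IsGalois.tower_top_of_isGalois F I _
  have : FiniteDimensional I (IntermediateField.extendScalars hA) :=
    FiniteDimensional.right F I _
  have : FiniteDimensional I (IntermediateField.extendScalars hB) :=
    FiniteDimensional.right F I _
  apply IntermediateField.LinearDisjoint.of_inf_eq_bot
  rw [eq_bot_iff]
  intro x hx
  have hxA : x ∈ A := (IntermediateField.mem_extendScalars hA).1 (IntermediateField.mem_inf.1 hx).1
  have hxB : x ∈ B := (IntermediateField.mem_extendScalars hB).1 (IntermediateField.mem_inf.1 hx).2
  have hxI : x ∈ I := h (IntermediateField.mem_inf.2 ⟨hxA, hxB⟩)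
  exact IntermediateField.mem_bot.2 ⟨⟨x, hxI⟩, IntermediateField.algebraMap_apply I ⟨x, hxI⟩⟩

/-- For intermediate fields `A`, `B` with `A` Galois, `[A ⊓ B : F] [A ⊔ B : F] = [A : F] [B : F]`. -/
theorem IntermediateField.finrank_inf_mul_finrank_sup {F E : Type*} [Field F] [Field E]
    [Algebra F E] (A B : IntermediateField F E) [IsGalois F A] [FiniteDimensional F A]
    [FiniteDimensional F B] :
    Module.finrank F ↥(A ⊓ B) * Module.finrank F ↥(A ⊔ B) =
      Module.finrank F A * Module.finrank F B := by
  obtain ⟨I, hI⟩ : ∃ I, A ⊓ B = I := ⟨_, rfl⟩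
  have hA : I ≤ A := hI ▸ inf_le_left
  have hB : I ≤ B := hI ▸ inf_le_right
  have h1 := (IntermediateField.linearDisjoint_extendScalars hA hB hI.le).finrank_sup
  rw [IntermediateField.extendScalars_sup] at h1
  rw [hI, ← IntermediateField.finrank_mul_finrank_extendScalars hA,
    ← IntermediateField.finrank_mul_finrank_extendScalars hB,
    ← IntermediateField.finrank_mul_finrank_extendScalars (hA.trans le_sup_left), h1]
  ring

/-- The compositum is cyclotomic of order `lcm a b`, so the degree formula and `φ(gcd) φ(lcm) = φ(a)
φ(b)` force `A ⊓ B` to have degree `φ(gcd)`, that of its subfield `C`. -/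
theorem IntermediateField.inf_of_isCyclotomicExtension {F E : Type*} [Field F] [Field E]
    [CharZero F] [Algebra F E] (hirr : ∀ n, 0 < n → Irreducible (Polynomial.cyclotomic n F))
    {a b : ℕ} [NeZero a] [NeZero b] (A B C : IntermediateField F E)
    [IsCyclotomicExtension {a} F A] [IsCyclotomicExtension {b} F B]
    [IsCyclotomicExtension {a.gcd b} F C] : A ⊓ B = C := by
  have : NeZero (a.gcd b) := ⟨Nat.gcd_ne_zero_left (NeZero.ne a)⟩
  have : NeZero (a.lcm b) := ⟨Nat.lcm_ne_zero (NeZero.ne a) (NeZero.ne b)⟩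
  have : FiniteDimensional F A := IsCyclotomicExtension.finite_of_singleton a F A
  have : FiniteDimensional F B := IsCyclotomicExtension.finite_of_singleton b F B
  have : IsGalois F A := IsCyclotomicExtension.isGalois {a} F A
  have hle : C ≤ A ⊓ B :=
    le_inf (IntermediateField.isCyclotomicExtension_le_of_dvd F E _ _ C A (Nat.gcd_dvd_left a b))
      (IntermediateField.isCyclotomicExtension_le_of_dvd F E _ _ C B (Nat.gcd_dvd_right a b))
  have : FiniteDimensional F ↥(A ⊓ B) :=
    FiniteDimensional.of_injective
      (IntermediateField.inclusion (inf_le_left (a := A) (b := B))).toLinearMap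
      (IntermediateField.inclusion_injective inf_le_left)
  refine (IntermediateField.eq_of_le_of_finrank_eq hle ?_).symm
  have hsup := IntermediateField.isCyclotomicExtension_lcm_sup F E a b A B
  have h := IntermediateField.finrank_inf_mul_finrank_sup A B
  rw [IsCyclotomicExtension.finrank (n := a.lcm b) ↥(A ⊔ B) (hirr _ (NeZero.pos _)),
    IsCyclotomicExtension.finrank (n := a) A (hirr _ (NeZero.pos _)),
    IsCyclotomicExtension.finrank (n := b) B (hirr _ (NeZero.pos _)),
    ← totient_gcd_mul_totient_lcm] at h
  rw [IsCyclotomicExtension.finrank (n := a.gcd b) C (hirr _ (NeZero.pos _))]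
  exact (Nat.eq_of_mul_eq_mul_right (Nat.totient_pos.2 (NeZero.pos _)) h).symm

theorem cyclotomicSubfield_inf (a b : ℕ) [NeZero a] [NeZero b] :
    cyclotomicSubfield a ⊓ cyclotomicSubfield b = cyclotomicSubfield (a.gcd b) := by
  have : NeZero (a.gcd b) := ⟨Nat.gcd_ne_zero_left (NeZero.ne a)⟩
  exact IntermediateField.inf_of_isCyclotomicExtension
    (a := a) (b := b)
    (fun n hn => Polynomial.cyclotomic.irreducible_rat hn) _ _ _

theorem charConductor_dvd {H : Type*} {χ : H → ℂ} {n : ℕ} [NeZero n]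
    (h : fieldOfValues χ ≤ cyclotomicSubfield n) : charConductor χ ∣ n := by
  have hn : n ∈ {n : ℕ | 0 < n ∧ fieldOfValues χ ≤ cyclotomicSubfield n} := ⟨NeZero.pos n, h⟩
  obtain ⟨hpos, hle⟩ : 0 < charConductor χ ∧ _ := Nat.sInf_mem ⟨n, hn⟩
  have : NeZero (charConductor χ) := ⟨hpos.ne'⟩
  -- The gcd is again admissible, so minimality applies to it.
  have hg : charConductor χ ≤ (charConductor χ).gcd n :=
    Nat.sInf_le ⟨Nat.gcd_pos_of_pos_left _ hpos, by
      rw [← cyclotomicSubfield_inf]; exact le_inf hle h⟩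
  rw [← (Nat.gcd_le_left n hpos).antisymm hg]
  exact Nat.gcd_dvd_right _ _

/-! ### Descent along extensions of degree prime to `k` -/

/-- If `F ≤ K` are fields with `F` containing the `k`-th roots of unity and `[K : F]` prime to `k`,
then an element of `K` whose `k`-th power lies in `F` lies in `F`. -/
theorem IntermediateField.mem_of_pow_mem_of_coprime {F₀ E : Type*} [Field F₀] [Field E]
    [Algebra F₀ E] {F K : IntermediateField F₀ E} (hFK : F ≤ K) {k : ℕ}
    (hroots : ∀ ζ : E, ζ ^ k = 1 → ζ ∈ F)
    (hcop : (Module.finrank F (IntermediateField.extendScalars hFK)).Coprime k)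
    {z : E} (hz : z ∈ K) (hzk : z ^ k ∈ F) : z ∈ F := by
  rcases eq_or_ne z 0 with rfl | hz0
  · exact zero_mem _
  set d := Module.finrank F (IntermediateField.extendScalars hFK)
  let w : IntermediateField.extendScalars hFK := ⟨z, hz⟩
  have hw0 : w ≠ 0 := fun h => hz0 (congrArg Subtype.val h)
  have hw : w ^ k = algebraMap F _ ⟨z ^ k, hzk⟩ := rfl
  -- Taking norms of `w ^ k = z ^ k` shows that `z ^ d` and the norm of `w` differ by a `k`-th root
  -- of unity, so `z ^ d ∈ F`; Bézout for `d` and `k` then yields `z`.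
  have hN : (Algebra.norm F w) ^ k = ⟨z ^ k, hzk⟩ ^ d := by
    rw [← map_pow, hw, Algebra.norm_algebraMap]
  have hN' : ((Algebra.norm F w : F) : E) ^ k = (z ^ d) ^ k := by
    have := congrArg (Subtype.val : F → E) hN
    simpa [← pow_mul, mul_comm] using this
  have hzd : z ^ d ∈ F := by
    have hne : ((Algebra.norm F w : F) : E) ^ k ≠ 0 := by
      rw [hN']; exact pow_ne_zero _ (pow_ne_zero _ hz0)
    have h1 : (z ^ d / ((Algebra.norm F w : F) : E)) ^ k = 1 := by
      rw [div_pow, ← hN', div_self hne]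
    by_cases h0 : ((Algebra.norm F w : F) : E) = 0
    · rw [h0] at hN'
      rcases Nat.eq_zero_or_pos k with rfl | hk
      · exact hroots _ (pow_zero _)
      · exact absurd hN'.symm (by rw [zero_pow hk.ne']; exact pow_ne_zero _ (pow_ne_zero _ hz0))
    · have := mul_mem (hroots _ h1) (Algebra.norm F w).2
      rwa [div_mul_cancel₀ _ h0] at this
  have hbez : z = (z ^ d) ^ (d.gcdA k) * (z ^ k) ^ (d.gcdB k) := by
    rw [← zpow_natCast z d, ← zpow_natCast z k, ← zpow_mul, ← zpow_mul, ← zpow_add₀ hz0,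
      ← Nat.gcd_eq_gcd_ab, hcop]
    simp
  rw [hbez]
  exact mul_mem (zpow_mem hzd _) (zpow_mem hzk _)

theorem IntermediateField.finrank_extendScalars_mul_totient {F E : Type*} [Field F] [Field E]
    [CharZero F] [Algebra F E] (hirr : ∀ n, 0 < n → Irreducible (Polynomial.cyclotomic n F))
    {a b : ℕ} [NeZero a] [NeZero b] {A B : IntermediateField F E}
    [IsCyclotomicExtension {a} F A] [IsCyclotomicExtension {b} F B] (h : A ≤ B) :
    a.totient * Module.finrank A (IntermediateField.extendScalars h) = b.totient := by
  have := IntermediateField.finrank_mul_finrank_extendScalars h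
  rwa [IsCyclotomicExtension.finrank (n := a) A (hirr _ (NeZero.pos _)),
    IsCyclotomicExtension.finrank (n := b) B (hirr _ (NeZero.pos _))] at this

theorem mem_cyclotomicSubfield_of_pow_mem {p : ℕ} (hp : p.Prime) {b m k : ℕ} [NeZero m]
    (hm : m.Coprime p) (hk : k ∣ m) {z : ℂ} (hz : z ∈ cyclotomicSubfield (p ^ (b + 1) * m))
    (hzk : z ^ k ∈ cyclotomicSubfield (p * m)) : z ∈ cyclotomicSubfield (p * m) := by
  have : NeZero p := ⟨hp.ne_zero⟩
  have : NeZero k := ⟨fun h0 => NeZero.ne m (by simpa [h0] using hk)⟩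
  have hle : cyclotomicSubfield (p * m) ≤ cyclotomicSubfield (p ^ (b + 1) * m) :=
    cyclotomicSubfield_mono (mul_dvd_mul_right (dvd_pow_self p (Nat.succ_ne_zero b)) m)
  refine IntermediateField.mem_of_pow_mem_of_coprime hle (k := k) (fun ζ hζ => ?_) ?_ hz hzk
  · exact cyclotomicSubfield_mono (hk.trans (dvd_mul_left m p))
      (mem_cyclotomicSubfield_of_pow_eq_one hζ)
  -- Comparing totients, the relative degree is `p ^ b`.
  · have h := IntermediateField.finrank_extendScalars_mul_totient
      (fun n hn => Polynomial.cyclotomic.irreducible_rat hn) (a := p * m) hle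
      (b := p ^ (b + 1) * m)
    rw [Nat.totient_mul (Nat.Coprime.pow_left _ hm.symm), Nat.totient_mul hm.symm,
      Nat.totient_prime hp, Nat.totient_prime_pow_succ hp,
      mul_assoc (p ^ b), mul_comm ((p - 1) * m.totient)] at h
    rw [Nat.eq_of_mul_eq_mul_right
      (Nat.mul_pos (Nat.sub_pos_of_lt hp.one_lt) (Nat.totient_pos.2 (NeZero.pos m))) h]
    exact (Nat.Coprime.coprime_dvd_left hk hm).symm.pow_left b

/-! ### Traces of operators of finite order -/

/-- An endomorphism of finite order of a complex vector space is diagonalizable. -/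
theorem Module.End.exists_eigenbasis_of_pow_eq_one {V : Type*} [AddCommGroup V] [Module ℂ V]
    [FiniteDimensional ℂ V] {T : Module.End ℂ V} {M : ℕ} (hM : 0 < M) (hT : T ^ M = 1) :
    ∃ (ι : Type) (_ : Fintype ι) (b : Module.Basis ι ℂ V) (μ : ι → ℂ),
      (∀ i, T (b i) = μ i • b i) ∧ ∀ i, μ i ^ M = 1 := by
  have hss : T.IsSemisimple := by
    refine Module.End.isSemisimple_of_squarefree_aeval_eq_zero (p := Polynomial.X ^ M - 1) ?_ ?_
    · exact (Polynomial.X_pow_sub_one_separable_iff.2 (Nat.cast_ne_zero.2 hM.ne')).squarefree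
    · simp [hT]
  let D := DirectSum.isInternal_submodule_of_iSupIndep_of_iSup_eq_top
    T.eigenspaces_iSupIndep hss.iSup_eigenspace_eq_top
  let b := D.collectedBasis fun μ => Module.finBasis ℂ (T.eigenspace μ)
  have hfin : Fintype (Σ μ : ℂ, Fin (Module.finrank ℂ (T.eigenspace μ))) :=
    FiniteDimensional.fintypeBasisIndex b
  have hb : ∀ i, T (b i) = i.1 • b i := fun i =>
    Module.End.mem_eigenspace_iff.1 (D.collectedBasis_mem _ i)
  refine ⟨_, hfin, b, fun i => i.1, hb, fun i => ?_⟩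
  have h1 := Module.End.HasEigenvector.pow_apply (f := T)
    ⟨Module.End.mem_eigenspace_iff.2 (hb i), b.ne_zero i⟩ M
  rw [hT, Module.End.one_apply] at h1
  have h2 : (i.1 ^ M - 1) • b i = 0 := by rw [sub_smul, one_smul, ← h1, sub_self]
  exact sub_eq_zero.1 ((smul_eq_zero.1 h2).resolve_right (b.ne_zero i))

theorem LinearMap.trace_eq_sum_of_eigenbasis {K V ι : Type*} [Field K] [AddCommGroup V] [Module K V]
    [Fintype ι] (b : Module.Basis ι K V) {T : Module.End K V} {μ : ι → K}
    (h : ∀ i, T (b i) = μ i • b i) : LinearMap.trace K V T = ∑ i, μ i := by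
  classical
  rw [LinearMap.trace_eq_matrix_trace K b, Matrix.trace]
  exact Finset.sum_congr rfl fun i _ => by simp [LinearMap.toMatrix_apply, h]

theorem trace_mem_cyclotomicSubfield {V : Type*} [AddCommGroup V] [Module ℂ V]
    [FiniteDimensional ℂ V] {T : Module.End ℂ V} {M : ℕ} [NeZero M] (hT : T ^ M = 1) :
    LinearMap.trace ℂ V T ∈ cyclotomicSubfield M := by
  obtain ⟨ι, _, b, μ, hb, hμ⟩ := Module.End.exists_eigenbasis_of_pow_eq_one (NeZero.pos M) hT
  rw [LinearMap.trace_eq_sum_of_eigenbasis b hb]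
  exact sum_mem fun i _ => mem_cyclotomicSubfield_of_pow_eq_one (hμ i)

theorem LinearMap.trace_eq_conj_of_mul_eq_one {V : Type*} [AddCommGroup V] [Module ℂ V]
    [FiniteDimensional ℂ V] {S T : Module.End ℂ V} {M : ℕ} (hM : 0 < M) (hT : T ^ M = 1)
    (hST : S * T = 1) : LinearMap.trace ℂ V S = conj (LinearMap.trace ℂ V T) := by
  obtain ⟨ι, _, b, μ, hb, hμ⟩ := Module.End.exists_eigenbasis_of_pow_eq_one hM hT
  have hS : ∀ i, S (b i) = conj (μ i) • b i := fun i => by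
    have h1 : S (T (b i)) = b i := by rw [← Module.End.mul_apply, hST, Module.End.one_apply]
    have h0 : μ i ≠ 0 := fun h0 => by simpa [h0, hM.ne'] using hμ i
    rw [hb, map_smul] at h1
    rw [← Complex.inv_eq_conj (Complex.norm_eq_one_of_pow_eq_one (hμ i) hM.ne'),
      eq_inv_smul_iff₀ h0, h1]
  rw [LinearMap.trace_eq_sum_of_eigenbasis b hb, LinearMap.trace_eq_sum_of_eigenbasis b hS, map_sum]

theorem Representation.character_inv_eq_conj {H V : Type*} [Group H] [Finite H] [AddCommGroup V]
    [Module ℂ V] [FiniteDimensional ℂ V] (ρ : Representation ℂ H V) (h : H) :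
    ρ.character h⁻¹ = conj (ρ.character h) :=
  LinearMap.trace_eq_conj_of_mul_eq_one (Nat.card_pos (α := H))
    (by rw [← map_pow, pow_card_eq_one', map_one])
    (by rw [← map_mul, inv_mul_cancel, map_one])

/-! ### Schur's lemma and averaging -/

/-- Schur's lemma. -/
theorem Representation.IsIrreducible.exists_eq_smul_one {H V : Type*} [Group H] [AddCommGroup V]
    [Module ℂ V] [FiniteDimensional ℂ V] {ρ : Representation ℂ H V} (hρ : ρ.IsIrreducible)
    {T : Module.End ℂ V} (hT : ∀ h, T * ρ h = ρ h * T) : ∃ c : ℂ, T = c • (1 : Module.End ℂ V) := by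
  obtain ⟨c, hc⟩ := (Representation.IsIrreducible.algebraMap_intertwiningMap_bijective_of_isAlgClosed
    (ρ := ρ)).2 ⟨T, hT⟩
  exact ⟨c, (congrArg Representation.IntertwiningMap.toLinearMap hc).symm⟩

theorem Representation.IsIrreducible.nontrivial {H V : Type*} [Group H] [AddCommGroup V]
    [Module ℂ V] {ρ : Representation ℂ H V} (hρ : ρ.IsIrreducible) : Nontrivial V := by
  have := (Representation.irreducible_iff_isSimpleModule_asModule ρ).1 hρ
  exact IsSimpleModule.nontrivial (MonoidAlgebra ℂ H) ρ.asModule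

theorem Representation.IsIrreducible.sum_conj_eq {H V : Type*} [Group H] [Fintype H]
    [AddCommGroup V] [Module ℂ V] [FiniteDimensional ℂ V] {ρ : Representation ℂ H V}
    (hρ : ρ.IsIrreducible) (A : Module.End ℂ V) :
    ∑ h : H, ρ h * A * ρ h⁻¹ =
      (Nat.card H * LinearMap.trace ℂ V A / Module.finrank ℂ V : ℂ) • (1 : Module.End ℂ V) := by
  have := hρ.nontrivial
  have hd : (Module.finrank ℂ V : ℂ) ≠ 0 := Nat.cast_ne_zero.2 Module.finrank_pos.ne'
  obtain ⟨c, hc⟩ := hρ.exists_eq_smul_one (T := ∑ h : H, ρ h * A * ρ h⁻¹) fun x => by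
    rw [Finset.sum_mul, Finset.mul_sum]
    refine (Fintype.sum_equiv (Equiv.mulLeft x) _ _ fun h => ?_).symm
    simp only [Equiv.coe_mulLeft, mul_inv_rev, map_mul, mul_assoc]
    rw [← map_mul ρ x⁻¹ x, inv_mul_cancel, map_one, mul_one]
  rw [hc]
  congr 1
  have ht := congrArg (LinearMap.trace ℂ V) hc
  have hconj : ∀ h : H, LinearMap.trace ℂ V (ρ h * A * ρ h⁻¹) = LinearMap.trace ℂ V A := fun h => by
    rw [LinearMap.trace_mul_comm, ← mul_assoc, ← map_mul, inv_mul_cancel, map_one, one_mul]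
  simp only [map_sum, hconj, map_smul, LinearMap.trace_one, Finset.sum_const, Finset.card_univ,
    nsmul_eq_mul, smul_eq_mul] at ht
  rw [Nat.card_eq_fintype_card, ht, mul_div_assoc, div_self hd, mul_one]

/-- If `ρ` is irreducible and `X` normalizes `ρ`, then the powers of the trace of `X` are rational
combinations of the traces of the elements `X ^ k * ρ h`. -/
theorem Representation.IsIrreducible.trace_pow_mem {H V : Type*} [Group H] [Finite H]
    [AddCommGroup V] [Module ℂ V] [FiniteDimensional ℂ V] {ρ : Representation ℂ H V}
    (hρ : ρ.IsIrreducible) {X : Module.End ℂ V} {ψ : H → H} (hX : ∀ h, ρ h * X = X * ρ (ψ h))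
    (F : IntermediateField ℚ ℂ) (k : ℕ) (hF : ∀ h, LinearMap.trace ℂ V (X ^ k * ρ h) ∈ F) :
    LinearMap.trace ℂ V X ^ k ∈ F := by
  have := Fintype.ofFinite H
  have := hρ.nontrivial
  have hd : (Module.finrank ℂ V : ℂ) ≠ 0 := Nat.cast_ne_zero.2 Module.finrank_pos.ne'
  have hH : (Nat.card H : ℂ) ≠ 0 := Nat.cast_ne_zero.2 Nat.card_pos.ne'
  have hψ : ∀ j : ℕ, ∀ h, ρ h * X ^ j = X ^ j * ρ (ψ^[j] h) := fun j => by
    induction j with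
    | zero => simp
    | succ j ih => intro h; rw [pow_succ', ← mul_assoc, hX, mul_assoc, ih, ← mul_assoc]; rfl
  -- Each step trades a factor `tr X` for a factor `X` inside the trace: the average of the
  -- conjugates `ρ x * X * ρ x⁻¹` is the scalar `tr X / dim V`, and each conjugate is `X` times some
  -- `ρ y`.
  have key : ∀ i j : ℕ, i + j = k → ∀ h,
      LinearMap.trace ℂ V X ^ i * LinearMap.trace ℂ V (X ^ j * ρ h) ∈ F := by
    intro i
    induction i with
    | zero => intro j hj h; rw [← hj] at hF; simpa using hF h
    | succ i ih =>
      intro j hj h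
      have hs := congrArg (fun T => LinearMap.trace ℂ V (T * (X ^ j * ρ h))) (hρ.sum_conj_eq X)
      simp only [Finset.sum_mul, map_sum, smul_mul_assoc, one_mul, map_smul, smul_eq_mul] at hs
      have e : LinearMap.trace ℂ V X ^ (i + 1) * LinearMap.trace ℂ V (X ^ j * ρ h) =
          (Module.finrank ℂ V / Nat.card H : ℂ) * ∑ x : H, LinearMap.trace ℂ V X ^ i *
            LinearMap.trace ℂ V (ρ x * X * ρ x⁻¹ * (X ^ j * ρ h)) := by
        rw [← Finset.mul_sum, hs]
        field_simp
        ring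
      rw [e]
      refine mul_mem (div_mem (natCast_mem F _) (natCast_mem F _)) (sum_mem fun x _ => ?_)
      have e2 : ρ x * X * ρ x⁻¹ * (X ^ j * ρ h) =
          X ^ (j + 1) * ρ (ψ^[j] (ψ x * x⁻¹) * h) := by
        rw [hX, mul_assoc X, ← map_mul, mul_assoc X, ← mul_assoc (ρ _), hψ, pow_succ', map_mul]
        simp only [mul_assoc]
      rw [e2]
      exact ih (j + 1) (by omega) _
  have h1 := key k 0 (by omega) 1
  rw [pow_zero, map_one, mul_one, LinearMap.trace_one] at h1
  have h2 := div_mem h1 (natCast_mem F (Module.finrank ℂ V))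
  rwa [mul_div_cancel_right₀ _ hd] at h2

theorem Representation.exists_intertwiningMap_ne_zero {H V W : Type*} [Group H] [Fintype H]
    [AddCommGroup V] [Module ℂ V] [FiniteDimensional ℂ V] [AddCommGroup W] [Module ℂ W]
    [FiniteDimensional ℂ W] (ρ : Representation ℂ H V) (σ : Representation ℂ H W)
    (h : ∑ x : H, σ.character x * ρ.character x⁻¹ ≠ 0) :
    ∃ f : Representation.IntertwiningMap ρ σ, f ≠ 0 := by
  have hH : (Nat.card H : ℂ) ≠ 0 := Nat.cast_ne_zero.2 Nat.card_pos.ne'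
  have : Invertible (Nat.card H : ℂ) := invertibleOfNonzero hH
  by_contra! h0
  have : Subsingleton (Representation.IntertwiningMap ρ σ) :=
    ⟨fun a b => (h0 a).trans (h0 b).symm⟩
  have := Representation.card_inv_mul_sum_char_mul_char_eq_finrank ρ σ
  rw [Module.finrank_zero_of_subsingleton, Nat.cast_zero] at this
  exact mul_ne_zero (inv_ne_zero hH) h this

theorem Representation.IsIrreducible.sum_character_mul_character_inv {H V : Type*} [Group H]
    [Fintype H] [AddCommGroup V] [Module ℂ V] [FiniteDimensional ℂ V] {ρ : Representation ℂ H V}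
    (hρ : ρ.IsIrreducible) : ∑ x : H, ρ.character x * ρ.character x⁻¹ ≠ 0 := by
  have hH : (Nat.card H : ℂ) ≠ 0 := Nat.cast_ne_zero.2 Nat.card_pos.ne'
  have : Invertible (Nat.card H : ℂ) := invertibleOfNonzero hH
  have := Representation.card_inv_mul_sum_char_mul_char_eq_finrank ρ ρ
  rw [Representation.IsIrreducible.finrank_intertwiningMap_self] at this
  intro h0
  simp [h0] at this

/-! ### Extension to `g` and Clifford theory -/

/-- An irreducible representation `ρ` of a normal subgroup `N` whose character is fixed by
conjugation by `g` extends to `g`: some invertible `X` acts on `ρ` like `g`, and `X ^ k = ρ (g ^ k)`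
where `g ^ k ∈ N`. -/
theorem Representation.IsIrreducible.exists_extension {G V : Type*} [Group G] {N : Subgroup G}
    [hN : N.Normal] [Finite N] [AddCommGroup V] [Module ℂ V] [FiniteDimensional ℂ V]
    {ρ : Representation ℂ N V} (hρ : ρ.IsIrreducible) (g : G)
    (hinv : ∀ n : N, ρ.character (MulAut.conjNormal g n) = ρ.character n) {k : ℕ} (hk : 0 < k)
    (hgk : g ^ k ∈ N) :
    ∃ X : Module.End ℂ V, (∀ n, X * ρ n = ρ (MulAut.conjNormal g n) * X) ∧
      X ^ k = ρ ⟨g ^ k, hgk⟩ := by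
  have := Fintype.ofFinite N
  have := hρ.nontrivial
  let σ : Representation ℂ N V := ρ.comp (MulAut.conjNormal g : N ≃* N).toMonoidHom
  have hσ : σ.character = ρ.character := funext hinv
  -- The conjugate `σ` of `ρ` by `g` has the same character, hence a nonzero intertwiner from `ρ`.
  obtain ⟨f, hf⟩ := Representation.exists_intertwiningMap_ne_zero ρ σ (by
    rw [hσ]; exact hρ.sum_character_mul_character_inv)
  have hinj := (Representation.IsIrreducible.injective_or_eq_zero f).resolve_right hf
  let X : Module.End ℂ V := f.toLinearMap
  have hX : ∀ n, X * ρ n = ρ (MulAut.conjNormal g n) * X := f.isIntertwining'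
  have hXinj : Function.Injective X := hinj
  have hXk : ∀ j : ℕ, ∀ n, X ^ j * ρ n = ρ (MulAut.conjNormal (g ^ j) n) * X ^ j := fun j => by
    induction j with
    | zero => simp
    | succ j ih =>
      intro n
      rw [pow_succ, mul_assoc, hX, ← mul_assoc, ih, mul_assoc, pow_succ, map_mul,
        MulAut.mul_apply]
  have hconj : ∀ n : N, MulAut.conjNormal (g ^ k) n = ⟨g ^ k, hgk⟩ * n * ⟨g ^ k, hgk⟩⁻¹ :=
    fun n => Subtype.ext (MulAut.conjNormal_apply _ _)
  obtain ⟨c, hc⟩ := hρ.exists_eq_smul_one (T := ρ ⟨g ^ k, hgk⟩⁻¹ * X ^ k) fun n => by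
    rw [mul_assoc, hXk, hconj, ← mul_assoc, ← map_mul, ← mul_assoc (ρ n), ← map_mul]
    congr 2
    simp [mul_assoc]
  have hc' : X ^ k = c • ρ ⟨g ^ k, hgk⟩ := by
    have := congrArg (ρ ⟨g ^ k, hgk⟩ * ·) hc
    simpa only [← mul_assoc, ← map_mul, mul_inv_cancel, map_one, one_mul, mul_smul_comm,
      mul_one] using this
  have hc0 : c ≠ 0 := by
    rintro rfl
    obtain ⟨v, hv⟩ := exists_ne (0 : V)
    have h1 : (X ^ k) v = 0 := by rw [hc', zero_smul, LinearMap.zero_apply]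
    have h2 : Function.Injective (X ^ k) := by
      rw [Module.End.coe_pow]; exact hXinj.iterate k
    exact hv (h2 (h1.trans (map_zero _).symm))
  -- Rescaling by a `k`-th root of `c⁻¹` removes the Schur scalar in `X ^ k = c • ρ (g ^ k)`.
  obtain ⟨d, hd⟩ := IsAlgClosed.exists_pow_nat_eq c⁻¹ hk
  refine ⟨d • X, fun n => by rw [smul_mul_assoc, hX, mul_smul_comm], ?_⟩
  rw [smul_pow, hd, hc', smul_smul, inv_mul_cancel₀ hc0, one_smul]

theorem LinearMap.trace_pi {K W ι : Type*} [Field K] [AddCommGroup W] [Module K W]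
    [FiniteDimensional K W] [Fintype ι] [DecidableEq ι] (T : Module.End K (ι → W)) :
    LinearMap.trace K (ι → W) T =
      ∑ i, LinearMap.trace K W (LinearMap.proj i ∘ₗ T ∘ₗ LinearMap.single K (fun _ => W) i) := by
  have h : T = ∑ i, (T ∘ₗ LinearMap.single K (fun _ => W) i) ∘ₗ LinearMap.proj i := by
    refine LinearMap.ext fun v => ?_
    rw [LinearMap.sum_apply]
    conv_lhs => rw [← Finset.univ_sum_single v, map_sum]
    rfl
  conv_lhs => rw [h, map_sum]
  exact Finset.sum_congr rfl fun i _ => LinearMap.trace_comp_comm' _ _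

/-- If the restriction of a representation `σ` of `G` to a normal subgroup `N` is a sum of copies
of an irreducible representation `ρ` extended to `g` by `X`, then the trace of `σ g` is
the trace of `X` times the trace of an operator of order dividing `k`. -/
theorem Representation.IsIrreducible.exists_trace_eq_mul {G V W : Type*} [Group G]
    {N : Subgroup G} [N.Normal] [AddCommGroup V] [Module ℂ V] [AddCommGroup W] [Module ℂ W]
    [FiniteDimensional ℂ W] {ρ : Representation ℂ N W} (hρ : ρ.IsIrreducible)
    (σ : Representation ℂ G V) {e : ℕ} (Φ : V ≃ₗ[ℂ] (Fin e → W))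
    (hΦ : ∀ (n : N) v i, Φ (σ n v) i = ρ n (Φ v i)) {g : G} {k : ℕ} (hk : 0 < k)
    (hgk : g ^ k ∈ N) {X : Module.End ℂ W} (hX : ∀ n, X * ρ n = ρ (MulAut.conjNormal g n) * X)
    (hXk : X ^ k = ρ ⟨g ^ k, hgk⟩) :
    ∃ Y : Module.End ℂ (Fin e → ℂ), Y ^ k = 1 ∧
      σ.character g = LinearMap.trace ℂ _ Y * LinearMap.trace ℂ W X := by
  have := hρ.nontrivial
  obtain ⟨Xi, hXi⟩ : ∃ Xi : Module.End ℂ W, Xi * X = 1 ∧ X * Xi = 1 := by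
    have h1 : ρ ⟨g ^ k, hgk⟩⁻¹ * ρ ⟨g ^ k, hgk⟩ = 1 := by rw [← map_mul, inv_mul_cancel, map_one]
    obtain ⟨j, rfl⟩ : ∃ j, k = j + 1 := ⟨k - 1, by omega⟩
    have h2 : (ρ ⟨g ^ (j + 1), hgk⟩⁻¹ * X ^ j) * X = 1 := by rw [mul_assoc, ← pow_succ, hXk, h1]
    exact ⟨_, h2, mul_eq_one_comm.1 h2⟩
  let T : Module.End ℂ (Fin e → W) := Φ.conj (σ g)
  have hT : ∀ (n : N) (v : Fin e → W),
      T (fun i => ρ n (v i)) = fun i => ρ (MulAut.conjNormal g n) (T v i) := fun n v => by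
    have h1 : (fun i => ρ n (v i)) = Φ (σ n (Φ.symm v)) := by
      ext i; rw [hΦ, LinearEquiv.apply_symm_apply]
    ext i
    change _ = ρ (MulAut.conjNormal g n) (Φ (σ g (Φ.symm v)) i)
    rw [← hΦ, h1]
    simp only [T, LinearEquiv.conj_apply_apply, LinearEquiv.symm_apply_apply]
    rw [← Module.End.mul_apply, ← Module.End.mul_apply, ← map_mul, ← map_mul]
    simp
  let S : Fin e → Fin e → Module.End ℂ W := fun i j =>
    LinearMap.proj i ∘ₗ T ∘ₗ LinearMap.single ℂ (fun _ => W) j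
  -- Each block of `T` satisfies the same commutation relation as `X`, so `X⁻¹` times the block is
  -- scalar by Schur; hence `T = Y ⊗ X`.
  have hS : ∀ i j, ∃ c : ℂ, S i j = c • X := fun i j => by
    have hSn : ∀ n, S i j * ρ n = ρ (MulAut.conjNormal g n) * S i j := fun n => by
      ext w
      have h1 : (Pi.single j (ρ n w) : Fin e → W) = fun l => ρ n ((Pi.single j w : Fin e → W) l) := by
        ext l
        rcases eq_or_ne l j with rfl | h
        · simp
        · simp [h]
      change T (Pi.single j (ρ n w)) i = _
      rw [h1, hT]
      rfl
    obtain ⟨c, hc⟩ := hρ.exists_eq_smul_one (T := Xi * S i j) fun n => by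
      have h1 : Xi * ρ (MulAut.conjNormal g n) = ρ n * Xi := by
        calc _ = Xi * (ρ (MulAut.conjNormal g n) * X) * Xi := by
              rw [mul_assoc, mul_assoc, hXi.2, mul_one]
          _ = _ := by rw [← hX, ← mul_assoc, hXi.1, one_mul]
      rw [mul_assoc, hSn, ← mul_assoc, h1, mul_assoc]
    refine ⟨c, ?_⟩
    rw [← one_mul (S i j), ← hXi.2, mul_assoc, hc, mul_smul_comm, mul_one]
  choose y hy using hS
  let Y : Matrix (Fin e) (Fin e) ℂ := Matrix.of y
  have hTS : ∀ j w, T (Pi.single j w) = fun i => Y i j • X w := fun j w => by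
    ext i
    exact congrArg (fun A : Module.End ℂ W => A w) (hy i j)
  have hTm : ∀ m : ℕ, ∀ j w, (T ^ m) (Pi.single j w) = fun i => (Y ^ m) i j • (X ^ m) w := fun m => by
    induction m with
    | zero =>
      intro j w
      ext i
      rcases eq_or_ne i j with rfl | h
      · simp
      · simp [h]
    | succ m ih =>
      intro j w
      have h1 : T (Pi.single j w) = ∑ l, Pi.single l (Y l j • X w) := by
        rw [hTS]; exact (Finset.univ_sum_single _).symm
      rw [pow_succ, Module.End.mul_apply, h1, map_sum]
      ext i
      simp only [Finset.sum_apply, ih, map_smul, pow_succ, Matrix.mul_apply, Module.End.mul_apply,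
        Finset.sum_smul, smul_smul]
  -- `T ^ k` is both `Y ^ k ⊗ X ^ k` and the action of `g ^ k ∈ N`, which is `1 ⊗ X ^ k`.
  have hYk : Y ^ k = 1 := by
    obtain ⟨w, hw⟩ := exists_ne (0 : W)
    ext i j
    have hTk : T ^ k = Φ.conj (σ (g ^ k)) := by
      rw [map_pow σ]
      exact (map_pow (Φ.conjAlgEquiv ℂ) (σ g) k).symm
    have h1 := congrFun (hTm k j w) i
    rw [hTk, LinearEquiv.conj_apply_apply, hXk] at h1
    have h2 := hΦ ⟨g ^ k, hgk⟩ (Φ.symm (Pi.single j w)) i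
    rw [LinearEquiv.apply_symm_apply] at h2
    rw [h2] at h1
    have h3 := congrArg (ρ ⟨g ^ k, hgk⟩⁻¹) h1
    rw [map_smul, ← Module.End.mul_apply, ← Module.End.mul_apply, ← map_mul, inv_mul_cancel,
      map_one, Module.End.one_apply, Module.End.one_apply] at h3
    rcases eq_or_ne i j with rfl | h
    · rw [Pi.single_eq_same] at h3
      have h4 : ((Y ^ k) i i - 1) • w = 0 := by rw [sub_smul, one_smul, ← h3, sub_self]
      rw [Matrix.one_apply_eq]
      exact sub_eq_zero.1 ((smul_eq_zero.1 h4).resolve_right hw)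
    · rw [Pi.single_eq_of_ne h] at h3
      rw [Matrix.one_apply_ne h]
      exact (smul_eq_zero.1 h3.symm).resolve_right hw
  refine ⟨Matrix.toLin' Y, ?_, ?_⟩
  · rw [← Matrix.toLin'_pow, hYk, Matrix.toLin'_one]; rfl
  · rw [Matrix.trace_toLin'_eq, Representation.character, ← LinearMap.trace_conj' (σ g) Φ,
      LinearMap.trace_pi, Matrix.trace, Finset.sum_mul]
    refine Finset.sum_congr rfl fun i _ => ?_
    change LinearMap.trace ℂ W (S i i) = _
    rw [hy, map_smul, smul_eq_mul]
    rfl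

/-- Clifford's theorem for an invariant constituent: if the character of the irreducible
representation `ρ` of a normal subgroup `N` is fixed by conjugation and is a constituent of the
restriction of the irreducible representation `σ`, then this restriction is a sum of copies of `ρ`. -/
theorem Representation.IsIrreducible.exists_linearEquiv_of_invariant {G V W : Type*} [Group G]
    {N : Subgroup G} [N.Normal] [Fintype N] [AddCommGroup V] [Module ℂ V] [FiniteDimensional ℂ V]
    [AddCommGroup W] [Module ℂ W] [FiniteDimensional ℂ W] {ρ : Representation ℂ N W}
    (hρ : ρ.IsIrreducible) {σ : Representation ℂ G V} (hσ : σ.IsIrreducible)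
    (hinv : ∀ (g : G) (n : N), ρ.character (MulAut.conjNormal g n) = ρ.character n)
    (hne : ∑ n : N, σ.character n * ρ.character n⁻¹ ≠ 0) :
    ∃ (e : ℕ) (Φ : V ≃ₗ[ℂ] (Fin e → W)), ∀ (n : N) v i, Φ (σ n v) i = ρ n (Φ v i) := by
  let σN : Representation ℂ N V := σ.comp N.subtype
  have : NeZero (Nat.card N : ℂ) := ⟨Nat.cast_ne_zero.2 Nat.card_pos.ne'⟩
  -- Invariance of the character makes this sum commute with all of `G`. Its trace is the sum in
  -- `hne`, so `c ≠ 0`.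
  obtain ⟨c, hc⟩ := hσ.exists_eq_smul_one (T := ∑ n : N, ρ.character n⁻¹ • σ n) fun g => by
    rw [Finset.sum_mul, Finset.mul_sum]
    refine (Fintype.sum_equiv (MulAut.conjNormal g : N ≃* N).toEquiv _ _ fun n => ?_).symm
    have h1 : ρ.character (MulAut.conjNormal g n)⁻¹ = ρ.character n⁻¹ := by
      rw [← map_inv, hinv]
    simp only [MulEquiv.toEquiv_eq_coe, EquivLike.coe_coe, h1, mul_smul_comm, smul_mul_assoc,
      MulAut.conjNormal_apply, ← map_mul, inv_mul_cancel_right]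
  have hc0 : c ≠ 0 := by
    rintro rfl
    apply hne
    have h1 := congrArg (LinearMap.trace ℂ V) hc
    simp only [map_sum, map_smul, smul_eq_mul, zero_smul, map_zero] at h1
    rw [← h1]
    exact Finset.sum_congr rfl fun n _ => mul_comm _ _
  -- The same nonzero scalar `c` acts on every simple submodule, so its character pairs nontrivially
  -- with that of `ρ` and it is isomorphic to `ρ`.
  have hiso : IsIsotypicOfType (MonoidAlgebra ℂ N) σN.asModule ρ.asModule := fun m hm => by
    let U : Subrepresentation σN := Subrepresentation.ofSubmodule' m
    let τ := U.toRepresentation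
    have hU : Nontrivial U.toSubmodule := IsSimpleModule.nontrivial (MonoidAlgebra ℂ N) m
    have h1 : ∑ n : N, ρ.character n⁻¹ • τ n = c • (1 : Module.End ℂ U.toSubmodule) := by
      refine LinearMap.ext fun u => Subtype.ext ?_
      have := congrArg (fun A : Module.End ℂ V => A u) hc
      simp only [LinearMap.sum_apply, LinearMap.smul_apply, Module.End.one_apply] at this ⊢
      rw [Submodule.coe_smul, ← this, AddSubmonoidClass.coe_finsetSum]
      rfl
    obtain ⟨f, hf⟩ := Representation.exists_intertwiningMap_ne_zero ρ τ (by
      have h2 := congrArg (LinearMap.trace ℂ _) h1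
      simp only [map_sum, map_smul, smul_eq_mul, LinearMap.trace_one] at h2
      have h3 : ∑ n : N, τ.character n * ρ.character n⁻¹ = c * Module.finrank ℂ U.toSubmodule := by
        rw [← h2]
        exact Finset.sum_congr rfl fun n _ => mul_comm _ _
      rw [h3]
      exact mul_ne_zero hc0 (Nat.cast_ne_zero.2 Module.finrank_pos.ne'))
    let f' : Representation.IntertwiningMap ρ σN :=
      ⟨U.toSubmodule.subtype ∘ₗ f.toLinearMap, fun n => by
        rw [LinearMap.comp_assoc, f.isIntertwining' n]; rfl⟩
    let F := LinearMap.codRestrict m (Representation.IntertwiningMap.equivLinearMapAsModule ρ σN f')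
      fun v => (f v).2
    have hF : F ≠ 0 := fun h0 => hf <| by
      refine Representation.IntertwiningMap.ext (LinearMap.ext fun v => Subtype.ext ?_)
      exact congrArg Subtype.val (LinearMap.congr_fun h0 v)
    exact ⟨(LinearEquiv.ofBijective F (LinearMap.bijective_of_ne_zero hF)).symm⟩
  have : Module.Finite (MonoidAlgebra ℂ N) σN.asModule :=
    Module.Finite.of_restrictScalars_finite ℂ _ _
  obtain ⟨e, ⟨E⟩⟩ := hiso.linearEquiv_fun
  refine ⟨e, E.restrictScalars ℂ, fun n v i => ?_⟩
  let v' : σN.asModule := v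
  have h1 := congrFun (E.map_smul (MonoidAlgebra.single n (1 : ℂ)) v') i
  rw [Pi.smul_apply, Representation.single_smul, Representation.single_smul, one_smul,
    one_smul] at h1
  exact h1

/-! ### Character values and the conductor bound -/

theorem charInner_character_eq {H V : Type*} [Group H] [Fintype H] [AddCommGroup V] [Module ℂ V]
    [FiniteDimensional ℂ V] (ρ : Representation ℂ H V) (χ : H → ℂ) :
    charInner χ ρ.character = (Nat.card H : ℂ)⁻¹ * ∑ h : H, χ h * ρ.character h⁻¹ := by
  rw [charInner, finsum_eq_sum_of_fintype]
  simp only [ρ.character_inv_eq_conj]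

/-- The values of an irreducible character `χ` over an invariant irreducible character `θ` of a
normal subgroup `N` with `G / N` of order prime to `p` lie in the cyclotomic field of order `p * m`
if those of `θ` do, where `m` is the largest divisor of the order of `G` prime to `p`. -/
theorem character_mem_cyclotomicSubfield {G V W : Type*} [Group G] [Finite G] {p : ℕ}
    (hp : p.Prime) {N : Subgroup G} [N.Normal] (hcop : (Nat.card (G ⧸ N)).Coprime p)
    [AddCommGroup V] [Module ℂ V] [FiniteDimensional ℂ V] [AddCommGroup W] [Module ℂ W]
    [FiniteDimensional ℂ W] {ρ : Representation ℂ N W} (hρ : ρ.IsIrreducible)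
    {σ : Representation ℂ G V} (hσ : σ.IsIrreducible) (hinv : IsGInvariant ρ.character)
    (hne : charInner (fun n : N => σ.character n) ρ.character ≠ 0) {a m : ℕ} (hm : m.Coprime p)
    (hcard : Nat.card G = p ^ a * m) (hθ : ∀ n, ρ.character n ∈ cyclotomicSubfield (p * m)) (g : G) :
    σ.character g ∈ cyclotomicSubfield (p * m) := by
  have := Fintype.ofFinite N
  have : NeZero p := ⟨hp.ne_zero⟩
  have : NeZero m := ⟨fun h0 => Nat.card_pos.ne' (by rw [hcard, h0, mul_zero])⟩
  have hinv' : ∀ (g : G) (n : N), ρ.character (MulAut.conjNormal g n) = ρ.character n := hinv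
  rw [charInner_character_eq] at hne
  obtain ⟨e, Φ, hΦ⟩ := hρ.exists_linearEquiv_of_invariant hσ hinv' (right_ne_zero_of_mul hne)
  set k := orderOf (g : G ⧸ N)
  have hk : 0 < k := orderOf_pos _
  have : NeZero k := ⟨hk.ne'⟩
  have hgk : g ^ k ∈ N := by
    rw [← QuotientGroup.eq_one_iff, QuotientGroup.mk_pow]
    exact pow_orderOf_eq_one _
  have hkQ : k ∣ Nat.card (G ⧸ N) := orderOf_dvd_natCard _
  have hkG : k ∣ Nat.card G := hkQ.trans (Subgroup.card_quotient_dvd_card N)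
  have hkm : k ∣ m :=
    ((hcop.coprime_dvd_left hkQ).pow_right a).dvd_of_dvd_mul_left (hcard ▸ hkG)
  obtain ⟨X, hX, hXk⟩ := hρ.exists_extension g (hinv' g) hk hgk
  obtain ⟨Y, hY, htr⟩ := hρ.exists_trace_eq_mul σ Φ hΦ hk hgk hX hXk
  rw [htr]
  refine mul_mem (cyclotomicSubfield_mono (hkm.trans (dvd_mul_left m p))
    (trace_mem_cyclotomicSubfield hY)) ?_
  -- The larger field has order `p ^ (a + 1) * m = p * |G|`, so it contains `ℚ_{pm}` even when `a =
  -- 0`.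
  refine mem_cyclotomicSubfield_of_pow_mem hp (b := a) hm hkm ?_ ?_
  · refine trace_mem_cyclotomicSubfield ?_
    obtain ⟨t, ht⟩ := hkG
    have h1 : X ^ Nat.card G = 1 := by
      rw [ht, pow_mul, hXk, ← map_pow]
      have : (⟨g ^ k, hgk⟩ : N) ^ t = 1 :=
        Subtype.ext (show (g ^ k) ^ t = 1 by rw [← pow_mul, ← ht, pow_card_eq_one'])
      rw [this, map_one]
    rw [pow_succ', mul_assoc, ← hcard, mul_comm, pow_mul, h1, one_pow]
  -- Since `X ^ k = ρ (g ^ k)`, the traces of `X ^ k * ρ n` are values of `θ`.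
  · refine hρ.trace_pow_mem (ψ := (MulAut.conjNormal g : N ≃* N).symm) (fun n => ?_) _ k fun n => ?_
    · rw [hX, MulEquiv.apply_symm_apply]
    · rw [hXk, ← map_mul]
      exact hθ _

theorem mainTheorem11 {G : Type*} [Group G] [Finite G] (p : ℕ) (hp : p.Prime)
    (N : Subgroup G) [N.Normal] (hsimple : IsSimpleGroup (G ⧸ N))
    (hcop : (Nat.card (G ⧸ N)).Coprime p)
    (θ : N → ℂ) (hθ : θ ∈ Irr N) (hinv : IsGInvariant θ) (hrat : IsPRational p θ)
    (χ : G → ℂ) (hχ : χ ∈ IrrOver θ) :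
    pPart p (charConductor χ) ≤ p := by
  have : NeZero p := ⟨hp.ne_zero⟩
  obtain ⟨a, m, hm, hcard⟩ := Nat.exists_eq_pow_mul_and_not_dvd Nat.card_pos.ne' (n := Nat.card G)
    p hp.ne_one
  have hmp : m.Coprime p := ((Nat.Prime.coprime_iff_not_dvd hp).2 hm).symm
  have : NeZero m := ⟨fun h0 => hm (h0 ▸ dvd_zero p)⟩
  have : NeZero (Nat.card N) := ⟨Nat.card_pos.ne'⟩
  obtain ⟨hpos, hθle⟩ := charConductor_spec hθ
  -- The conductor of `θ` divides `|N|`, hence `p ^ a * m`, and `p`-rationality makes it prime to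
  -- `p`.
  have hc : charConductor θ ∣ m := by
    have h1 : charConductor θ ∣ p ^ a * m := hcard ▸
      (charConductor_dvd (fieldOfValues_le_cyclotomicSubfield hθ)).trans
        (Subgroup.card_subgroup_dvd_card N)
    have h2 : ¬ p ∣ charConductor θ := fun h => by
      have h3 := (hp.dvd_iff_one_le_factorization hpos.ne').1 h
      exact absurd hrat (Nat.one_lt_pow (by omega) hp.one_lt).ne'
    exact (((Nat.Prime.coprime_iff_not_dvd hp).2 h2).symm.pow_right a).dvd_of_dvd_mul_left h1
  have hθmem : ∀ n, θ n ∈ cyclotomicSubfield (p * m) := fun n =>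
    cyclotomicSubfield_mono (hc.trans (dvd_mul_left m p))
      (hθle (IntermediateField.subset_adjoin ℚ _ (Set.mem_range_self n)))
  obtain ⟨d, ρ, hρ, rfl⟩ := hθ
  obtain ⟨⟨D, σ, hσ, rfl⟩, hne⟩ := hχ
  have hle : fieldOfValues σ.character ≤ cyclotomicSubfield (p * m) := by
    refine IntermediateField.adjoin_le_iff.2 ?_
    rintro _ ⟨g, rfl⟩
    exact character_mem_cyclotomicSubfield hp hcop hρ hσ hinv hne hmp hcard hθmem g
  have h1 := (Nat.factorization_le_iff_dvd
    (charConductor_spec ⟨D, σ, hσ, rfl⟩).1.ne' (NeZero.ne _)).2 (charConductor_dvd hle) p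
  rw [Nat.factorization_mul hp.ne_zero (NeZero.ne m), Finsupp.add_apply,
    hp.factorization_self, Nat.factorization_eq_zero_of_not_dvd hm] at h1
  calc pPart p _ ≤ p ^ 1 := Nat.pow_le_pow_right hp.pos h1
    _ = p := pow_one p
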